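/- Let $(M,\omega)$ be a symplectic manifold of dimension $2n$, that is, a smooth manifold (Hausdorff, second countable, without boundary) with a closed, nondegenerate smooth $2$-form $\omega$, oriented by $\omega^n$. Let $\mathfrak X^{c}_{ex}(M,\omega)$ be the set of all smooth vector fields $X$ on $M$ with compact support for which $i_X\omega = dh$ for some smooth function $h\colon M\to\mathbb R$ (the compactly supported Hamiltonian vector fields). Then $\mathfrak X^{c}_{ex}(M,\omega)$ is big enough to detect the vanishing of a symmetric $2$-tensor field: if $T\in\Gamma(S^2T^*M)$ is a smooth symmetric $2$-tensor field such that $$\int_M T(X,Y)\,\omega^n = 0 \quad\text{for all } X,Y\in\mathfrak X^{c}_{ex}(M,\omega),$$ then $T=0$. -/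

import Mathlib

open scoped Manifold ContDiff
open MeasureTheory

noncomputable section

/-- A smooth differential `k`-form on a manifold `M` without boundary modelled on `E`: an
alternating `k`-linear form on each tangent space, whose pullback by the inverse of each chart is
a smooth function on the target of the chart. -/
structure DiffForm (E : Type*) [NormedAddCommGroup E] [NormedSpace ℝ E] (M : Type*)
    [TopologicalSpace M] [ChartedSpace E M] (k : ℕ) where
  /-- the value at a point -/
  val : ∀ x : M, TangentSpace 𝓘(ℝ, E) x [⋀^Fin k]→L[ℝ] ℝ
  smooth : ∀ φ ∈ atlas E M, ContDiffOn ℝ ∞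
    (fun y : E => ((val (φ.symm y)).compContinuousLinearMap
      (mfderiv 𝓘(ℝ, E) 𝓘(ℝ, E) φ.symm y) : E [⋀^Fin k]→L[ℝ] ℝ)) φ.target

namespace DiffForm

variable {E : Type*} [NormedAddCommGroup E] [NormedSpace ℝ E] {M : Type*}
  [TopologicalSpace M] [ChartedSpace E M] {k : ℕ}

/-- The coordinate representation `(φ⁻¹)^* α` of a form `α` in the chart `φ`. -/
def inChart (α : DiffForm E M k) (φ : OpenPartialHomeomorph M E) (y : E) :
    E [⋀^Fin k]→L[ℝ] ℝ :=
  (α.val (φ.symm y)).compContinuousLinearMap (mfderiv 𝓘(ℝ, E) 𝓘(ℝ, E) φ.symm y)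

/-- `dα = 0`: in every chart the exterior derivative of the coordinate representation vanishes. -/
def Closed (α : DiffForm E M k) : Prop :=
  ∀ φ ∈ atlas E M, ∀ y ∈ φ.target, extDeriv (α.inChart φ) y = 0

/-- A symplectic form: a closed 2-form that is nondegenerate on every tangent space. -/
def IsSymplectic (Ω : DiffForm E M 2) : Prop :=
  Ω.Closed ∧
    ∀ (x : M) (v : TangentSpace 𝓘(ℝ, E) x), (∀ w, Ω.val x ![v, w] = 0) → v = 0

end DiffForm

/-- The value `(α ∧ ⋯ ∧ α) (v₁, …, v₂ₙ)` of the `n`-th exterior power of an alternating 2-form: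
`2⁻ⁿ ∑_σ sign σ ∏ᵢ α (v_{σ(2i-1)}, v_{σ(2i)})`, the sum being over all permutations. -/
def wedgePow {V : Type*} [AddCommGroup V] [Module ℝ V] [TopologicalSpace V]
    (α : V [⋀^Fin 2]→L[ℝ] ℝ) (n : ℕ) (v : Fin (2 * n) → V) : ℝ :=
  (2 ^ n)⁻¹ * ∑ σ : Equiv.Perm (Fin (2 * n)), ((Equiv.Perm.sign σ : ℤ) : ℝ) *
    ∏ i : Fin n, α ![v (σ ⟨2 * i, by omega⟩), v (σ ⟨2 * i + 1, by omega⟩)]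

section

variable (n : ℕ) (M : Type*) [TopologicalSpace M]
  [ChartedSpace (EuclideanSpace ℝ (Fin (2 * n))) M]
  [IsManifold 𝓘(ℝ, EuclideanSpace ℝ (Fin (2 * n))) ∞ M]

/-- The smooth vector fields on `M`. -/
abbrev SmoothVectorField :=
  Cₛ^∞⟮𝓘(ℝ, EuclideanSpace ℝ (Fin (2 * n))); EuclideanSpace ℝ (Fin (2 * n)),
    fun x : M => TangentSpace 𝓘(ℝ, EuclideanSpace ℝ (Fin (2 * n))) x⟯

/-- The smooth tensor fields of type `(0, 2)` on `M`: smooth families of bilinear forms on the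
tangent spaces. -/
abbrev SmoothTwoTensor :=
  Cₛ^∞⟮𝓘(ℝ, EuclideanSpace ℝ (Fin (2 * n)));
    EuclideanSpace ℝ (Fin (2 * n)) →L[ℝ] EuclideanSpace ℝ (Fin (2 * n)) →L[ℝ] ℝ,
    fun x : M => TangentSpace 𝓘(ℝ, EuclideanSpace ℝ (Fin (2 * n))) x →L[ℝ]
      TangentSpace 𝓘(ℝ, EuclideanSpace ℝ (Fin (2 * n))) x →L[ℝ] ℝ⟯

/-- A smooth partition of unity `(ρ_p)_{p ∈ M}` subordinate to the cover of `M` by the domains of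
the charts `chartAt _ p`. -/
def chartPartition [T2Space M] [SigmaCompactSpace M] :
    SmoothPartitionOfUnity M 𝓘(ℝ, EuclideanSpace ℝ (Fin (2 * n))) M :=
  Classical.choose (SmoothPartitionOfUnity.exists_isSubordinate_chartAt_source
    𝓘(ℝ, EuclideanSpace ℝ (Fin (2 * n))) M)

end

section

variable {n : ℕ} {M : Type*} [TopologicalSpace M]
  [ChartedSpace (EuclideanSpace ℝ (Fin (2 * n))) M]
  [IsManifold 𝓘(ℝ, EuclideanSpace ℝ (Fin (2 * n))) ∞ M]

/-- The integral `∫_M f Ωⁿ`, for `f` continuous with compact support: the sum over the partition of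
unity of the integrals of `ρ_p f Ωⁿ`, computed in the chart at `p`. The manifold carries the
orientation given by `Ωⁿ`, so that in a chart, whether it preserves the orientation or not, the
integral of `g Ωⁿ` is the Lebesgue integral of `g |Ωⁿ(∂₁, …, ∂₂ₙ)|`. -/
def symplecticIntegral [T2Space M] [SigmaCompactSpace M]
    (Ω : DiffForm (EuclideanSpace ℝ (Fin (2 * n))) M 2) (f : M → ℝ) : ℝ :=
  ∑ᶠ p : M, ∫ y in (chartAt (EuclideanSpace ℝ (Fin (2 * n))) p).target,
    chartPartition n M p ((chartAt (EuclideanSpace ℝ (Fin (2 * n))) p).symm y) *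
      f ((chartAt (EuclideanSpace ℝ (Fin (2 * n))) p).symm y) *
      |wedgePow (Ω.inChart (chartAt (EuclideanSpace ℝ (Fin (2 * n))) p) y) n
        (fun j => EuclideanSpace.single j (1 : ℝ))|

/-- The compactly supported Hamiltonian vector fields of `(M, Ω)`: the smooth vector fields `X` with
compact support such that `Ω(X, ·) = dh` for some smooth function `h` on `M`. -/
def compactHamiltonianFields (Ω : DiffForm (EuclideanSpace ℝ (Fin (2 * n))) M 2) :
    Set (SmoothVectorField n M) :=
  {X | IsCompact (closure {x : M | X x ≠ 0}) ∧
    ∃ h : M → ℝ, ContMDiff 𝓘(ℝ, EuclideanSpace ℝ (Fin (2 * n))) 𝓘(ℝ, ℝ) ∞ h ∧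
      ∀ (x : M) (v : TangentSpace 𝓘(ℝ, EuclideanSpace ℝ (Fin (2 * n))) x),
        Ω.val x ![X x, v] = mfderiv 𝓘(ℝ, EuclideanSpace ℝ (Fin (2 * n))) 𝓘(ℝ, ℝ) h x v}

/-- A set `𝔤` of (compactly supported) vector fields is big enough to detect the vanishing of a
symmetric 2-tensor field: a smooth symmetric 2-tensor field `T` with `∫_M T(X, Y) Ωⁿ = 0` for all
`X, Y ∈ 𝔤` is zero. -/
def DetectsSymmetricTensors [T2Space M] [SigmaCompactSpace M]
    (Ω : DiffForm (EuclideanSpace ℝ (Fin (2 * n))) M 2) (𝔤 : Set (SmoothVectorField n M)) : Prop :=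
  ∀ T : SmoothTwoTensor n M, (∀ (x : M) (v w), T x v w = T x w v) →
    (∀ X ∈ 𝔤, ∀ Y ∈ 𝔤, symplecticIntegral Ω (fun x => T x (X x) (Y x)) = 0) →
    ∀ (x : M) (v w), T x v w = 0

end

end

noncomputable section

/-! Write `X_h` for the Hamiltonian field of `h`. For `a` smooth with compact support and `φ` any
smooth function, `a cos φ` and `a sin φ` generate compactly supported Hamiltonian fields. Since `h ↦
X_h` is a derivation, summing `T(X_h, X_h)` over these two functions cancels the cross terms and
leaves `T(X_a, X_a) + a² T(X_φ, X_φ)` (`hamiltonianEnergy_cos_add_sin`). The hypothesis kills the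
integrals of both terms on the left and of `T(X_a, X_a)`, hence `∫ a² T(X_φ, X_φ) Ωⁿ = 0` for every
such `a`.

A bump function `a` supported where `T(X_φ, X_φ)` has constant sign then forces `T(X_φ, X_φ) = 0`
pointwise (`hamiltonianEnergy_eq_zero`). By nondegeneracy every tangent vector is a value of some
`X_φ`, so `T(v, v) = 0`, and polarisation gives `T = 0`.

The integral must be additive on continuous compactly supported functions and strictly positive on
nonzero nonnegative ones. Strict positivity rests on `Ωⁿ` vanishing nowhere
(`wedgePow_basis_ne_zero`), which follows from the existence of symplectic bases. -/

/-! ### Linear algebra: symplectic families and the top exterior power. -/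

theorem exists_symplectic_family (n : ℕ) : ∀ {V : Type*} [AddCommGroup V] [Module ℝ V]
    [FiniteDimensional ℝ V] (B : V →ₗ[ℝ] V →ₗ[ℝ] ℝ), (∀ v, B v v = 0) →
    (∀ v, (∀ w, B v w = 0) → v = 0) → Module.finrank ℝ V = 2 * n →
    ∃ b : Fin n × Fin 2 → V, (∀ i, B (b (i, 0)) (b (i, 1)) = 1) ∧
      ∀ p q, p.1 ≠ q.1 → B (b p) (b q) = 0 := by
  induction n with
  | zero =>
    intro V _ _ _ B _ _ _
    exact ⟨fun p => p.1.elim0, fun i => i.elim0, fun p => p.1.elim0⟩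
  | succ n ih =>
    intro V _ _ _ B halt hnd hdim
    have hskew : ∀ v w, B v w = -B w v := fun v w => by
      have := halt (v + w)
      simp only [map_add, LinearMap.add_apply, halt] at this
      linarith
    have : Nontrivial V := Module.nontrivial_of_finrank_pos (R := ℝ) (by omega)
    obtain ⟨u, hu⟩ := exists_ne (0 : V)
    obtain ⟨w₀, hw₀⟩ : ∃ w, B u w ≠ 0 := by
      by_contra! h
      exact hu (hnd u h)
    obtain ⟨w, hw⟩ : ∃ w, B u w = 1 := ⟨(B u w₀)⁻¹ • w₀, by simp [hw₀]⟩
    have hwu : B w u = -1 := by rw [hskew, hw]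
    -- `ker F` is the symplectic complement of the hyperbolic plane spanned by `u` and `w`. It has
    -- codimension 2 and inherits nondegeneracy, because any `v` can be corrected into it by a
    -- combination of `u` and `w`.
    let F : V →ₗ[ℝ] ℝ × ℝ := (B u).prod (B w)
    have hF : ∀ x : LinearMap.ker F, B u x = 0 ∧ B w x = 0 := fun x => by
      have := x.2
      rw [LinearMap.mem_ker] at this
      exact ⟨congrArg Prod.fst this, congrArg Prod.snd this⟩
    have hsurj : LinearMap.range F = ⊤ := by
      rw [LinearMap.range_eq_top]
      rintro ⟨s, t⟩
      refine ⟨s • w - t • u, ?_⟩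
      simp [F, halt, hw, hwu]
    have hker : Module.finrank ℝ (LinearMap.ker F) = 2 * n := by
      have := F.finrank_range_add_finrank_ker
      rw [hsurj, finrank_top, Module.finrank_prod, Module.finrank_self] at this
      omega
    obtain ⟨b, hb1, hb0⟩ := ih (B.domRestrict₁₂ (LinearMap.ker F) (LinearMap.ker F))
      (fun v => halt v) (fun x hx => by
        ext
        refine hnd _ fun v => ?_
        have hv : v - (B u v • w - B w v • u) ∈ LinearMap.ker F := by
          simp [F, halt, hw, hwu]
        have h := hx ⟨_, hv⟩
        simp only [LinearMap.domRestrict₁₂_apply, map_sub, map_smul] at h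
        rw [hskew x w, hskew x u, (hF x).1, (hF x).2] at h
        simpa using h) hker
    let b' : Fin (n + 1) → Fin 2 → V :=
      Fin.cons ![u, w] (fun i a => (b (i, a) : V))
    have key : ∀ (a : Fin 2) (x : LinearMap.ker F), B (![u, w] a) x = 0 := fun a x => by
      fin_cases a
      exacts [(hF x).1, (hF x).2]
    refine ⟨fun p => b' p.1 p.2, fun i => ?_, ?_⟩
    · refine Fin.cases ?_ (fun i => ?_) i
      · simpa [b'] using hw
      · exact hb1 i
    · rintro ⟨i, a⟩ ⟨j, c⟩
      refine Fin.cases ?_ (fun i => ?_) i <;> refine Fin.cases ?_ (fun j => ?_) j <;> intro hij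
      · exact (hij rfl).elim
      · exact key a _
      · rw [hskew]
        exact neg_eq_zero.2 (key c _)
      · exact hb0 (i, a) (j, c) fun h => hij (congrArg Fin.succ h)

/-- The pairing `(i, a) ↦ 2 i + a`. -/
def finPairEquiv (n : ℕ) : Fin n × Fin 2 ≃ Fin (2 * n) :=
  finProdFinEquiv.trans (finCongr (Nat.mul_comm n 2))

theorem finPairEquiv_zero {n : ℕ} (i : Fin n) (h : 2 * (i : ℕ) < 2 * n) :
    finPairEquiv n (i, 0) = ⟨2 * i, h⟩ := by
  ext; simp [finPairEquiv]

theorem finPairEquiv_one {n : ℕ} (i : Fin n) (h : 2 * (i : ℕ) + 1 < 2 * n) :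
    finPairEquiv n (i, 1) = ⟨2 * i + 1, h⟩ := by
  ext; simp [finPairEquiv, Nat.add_comm]

section

variable {V : Type*} [AddCommGroup V] [Module ℝ V] [TopologicalSpace V]

/-- The multilinear form `v ↦ ∏ᵢ α (v_{2i}, v_{2i+1})`. -/
def pairProduct (α : V [⋀^Fin 2]→L[ℝ] ℝ) (n : ℕ) :
    MultilinearMap ℝ (fun _ : Fin (2 * n) => V) ℝ :=
  MultilinearMap.domDomCongr ((Equiv.sigmaEquivProd (Fin n) (Fin 2)).trans (finPairEquiv n))
    ((MultilinearMap.mkPiAlgebra ℝ (Fin n) ℝ).compMultilinearMap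
      (fun _ : Fin n => α.toMultilinearMap))

theorem pairProduct_apply (α : V [⋀^Fin 2]→L[ℝ] ℝ) (n : ℕ) (v : Fin (2 * n) → V) :
    pairProduct α n v =
      ∏ i : Fin n, α ![v (finPairEquiv n (i, 0)), v (finPairEquiv n (i, 1))] := by
  simp only [pairProduct, MultilinearMap.domDomCongr_apply,
    MultilinearMap.compMultilinearMap_apply, MultilinearMap.mkPiAlgebra_apply]
  refine Finset.prod_congr rfl fun i _ => ?_
  change α _ = _
  congr 1
  ext a
  fin_cases a <;> rfl

/-- Exhibits the explicit sum as an alternating map, so that in top degree it is a multiple of the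
determinant. -/
theorem wedgePow_eq (α : V [⋀^Fin 2]→L[ℝ] ℝ) (n : ℕ) (v : Fin (2 * n) → V) :
    wedgePow α n v = (2 ^ n)⁻¹ * MultilinearMap.alternatization (pairProduct α n) v := by
  rw [wedgePow, MultilinearMap.alternatization_apply]
  congr 1
  refine Finset.sum_congr rfl fun σ _ => ?_
  rw [MultilinearMap.domDomCongr_apply, pairProduct_apply, Units.smul_def, zsmul_eq_mul]
  congr 1
  refine Finset.prod_congr rfl fun i _ => ?_
  rw [finPairEquiv_zero i (by omega), finPairEquiv_one i (by omega)]

/-- The bilinear form underlying an alternating form in two variables. -/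
def pairingForm (α : V [⋀^Fin 2]→L[ℝ] ℝ) : V →ₗ[ℝ] V →ₗ[ℝ] ℝ :=
  have hup0 : ∀ x y z : V, Function.update ![x, y] 0 z = ![z, y] := fun x y z => by
    ext a
    fin_cases a <;> rfl
  have hup1 : ∀ x y z : V, Function.update ![x, y] 1 z = ![x, z] := fun x y z => by
    ext a
    fin_cases a <;> rfl
  LinearMap.mk₂ ℝ (fun v w => α ![v, w])
    (fun x x' y => by simpa [hup0] using α.map_update_add ![x, y] 0 x x')
    (fun c x y => by simpa [hup0] using α.map_update_smul ![x, y] 0 c x)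
    (fun x y y' => by simpa [hup1] using α.map_update_add ![x, y] 1 y y')
    (fun c x y => by simpa [hup1] using α.map_update_smul ![x, y] 1 c y)

theorem alternating_swap (α : V [⋀^Fin 2]→L[ℝ] ℝ) (v w : V) : α ![w, v] = -α ![v, w] := by
  have := α.toAlternatingMap.map_swap ![v, w] (i := 0) (j := 1) (by decide)
  refine Eq.trans ?_ this
  change α _ = α _
  congr 1
  ext a
  fin_cases a <;> rfl

/-- Unless `σ` maps pairs to pairs, some factor vanishes. Otherwise `σ` is a permutation `τ` of the
pairs composed with flips `ε i` inside them. As `τ` acts on two copies of `Fin n`, it contributes an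
even permutation, so `sign σ` is the product of the signs of the flips. The product of the values of
`α` is the same number, and the term is a square. -/
theorem sign_mul_prod_nonneg {n : ℕ} (α : V [⋀^Fin 2]→L[ℝ] ℝ) (b : Fin n × Fin 2 → V)
    (h1 : ∀ i, α ![b (i, 0), b (i, 1)] = 1) (h0 : ∀ p q, p.1 ≠ q.1 → α ![b p, b q] = 0)
    (σ : Equiv.Perm (Fin n × Fin 2)) :
    0 ≤ ((Equiv.Perm.sign σ : ℤ) : ℝ) * ∏ i : Fin n, α ![b (σ (i, 0)), b (σ (i, 1))] := by
  by_cases h : ∃ i, (σ (i, 0)).1 ≠ (σ (i, 1)).1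
  · obtain ⟨i, hi⟩ := h
    rw [Finset.prod_eq_zero (Finset.mem_univ i) (h0 _ _ hi), mul_zero]
  push Not at h
  have hσ : ∀ i a, (σ (i, a)).1 = (σ (i, 0)).1 := fun i a => by
    fin_cases a
    exacts [rfl, (h i).symm]
  have hτ : Function.Bijective fun i => (σ (i, 0)).1 := by
    refine Finite.surjective_iff_bijective.1 fun j => ?_
    obtain ⟨⟨i, a⟩, hi⟩ := σ.surjective (j, 0)
    exact ⟨i, by rw [← hσ i a, hi]⟩
  have hε : ∀ i, Function.Bijective fun a => (σ (i, a)).2 := fun i =>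
    Finite.injective_iff_bijective.1 fun a c hac => by
      have : σ (i, a) = σ (i, c) := Prod.ext (by rw [hσ i a, hσ i c]) hac
      simpa using this
  let τ : Equiv.Perm (Fin n) := Equiv.ofBijective _ hτ
  let ε : Fin n → Equiv.Perm (Fin 2) := fun i => Equiv.ofBijective _ (hε i)
  have hdecomp : σ = (Equiv.prodCongrLeft fun _ : Fin 2 => τ) * Equiv.prodCongrRight ε := by
    ext1 ⟨i, a⟩
    exact Prod.ext (hσ i a) rfl
  have hsign : Equiv.Perm.sign σ = ∏ i, Equiv.Perm.sign (ε i) := by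
    rw [hdecomp, Equiv.Perm.sign_mul, Equiv.Perm.sign_prodCongrLeft,
      Equiv.Perm.sign_prodCongrRight, Fin.prod_univ_two, Int.units_mul_self, one_mul]
  have hpair : ∀ (j : Fin n) (e : Equiv.Perm (Fin 2)),
      α ![b (j, e 0), b (j, e 1)] = ((Equiv.Perm.sign e : ℤ) : ℝ) := fun j e => by
    have he : e = 1 ∨ e = Equiv.swap 0 1 := by
      revert e
      decide
    rcases he with rfl | rfl
    · simpa using h1 j
    · rw [Equiv.swap_apply_left, Equiv.swap_apply_right, alternating_swap, h1,
        Equiv.Perm.sign_swap (by decide)]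
      simp
  have hterm : ∀ i, α ![b (σ (i, 0)), b (σ (i, 1))] = ((Equiv.Perm.sign (ε i) : ℤ) : ℝ) :=
    fun i => by
      have h1 : σ (i, 1) = (τ i, ε i 1) := by
        refine Prod.ext ?_ rfl
        exact hσ i 1
      rw [← hpair (τ i) (ε i), h1]
      rfl
  rw [Finset.prod_congr rfl fun i _ => hterm i, hsign, Units.coe_prod, Int.cast_prod]
  exact mul_self_nonneg _

/-- The top exterior power of a nondegenerate alternating form does not vanish on a basis. -/
theorem wedgePow_basis_ne_zero {n : ℕ} (α : V [⋀^Fin 2]→L[ℝ] ℝ)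
    (hα : ∀ v, (∀ w, α ![v, w] = 0) → v = 0) (e : Module.Basis (Fin (2 * n)) ℝ V) :
    wedgePow α n e ≠ 0 := by
  intro he
  have : FiniteDimensional ℝ V := e.finiteDimensional_of_finite
  obtain ⟨b, h1, h0⟩ := exists_symplectic_family n (pairingForm α)
    (fun v => α.map_eq_zero_of_eq ![v, v] (i := 0) (j := 1) rfl (by decide)) hα
    (by rw [Module.finrank_eq_card_basis e, Fintype.card_fin])
  -- A top-degree alternating map that vanishes on one basis vanishes identically. It can therefore
  -- be tested on the symplectic family, without knowing that this family is a basis: all terms are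
  -- nonnegative and the identity permutation contributes 1.
  have hzero : MultilinearMap.alternatization (pairProduct α n) = 0 := by
    rw [wedgePow_eq] at he
    rw [AlternatingMap.eq_smul_basis_det e (MultilinearMap.alternatization (pairProduct α n)),
      (mul_eq_zero.1 he).resolve_left (by positivity), zero_smul]
  have hsum := DFunLike.congr_fun hzero (b ∘ (finPairEquiv n).symm)
  rw [MultilinearMap.alternatization_apply, AlternatingMap.zero_apply,
    ← (finPairEquiv n).permCongr.sum_comp] at hsum
  have hterm : ∀ σ : Equiv.Perm (Fin n × Fin 2),
      Equiv.Perm.sign ((finPairEquiv n).permCongr σ) • (MultilinearMap.domDomCongr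
        ((finPairEquiv n).permCongr σ) (pairProduct α n)) (b ∘ (finPairEquiv n).symm) =
      ((Equiv.Perm.sign σ : ℤ) : ℝ) * ∏ i : Fin n, α ![b (σ (i, 0)), b (σ (i, 1))] := fun σ => by
    rw [MultilinearMap.domDomCongr_apply, pairProduct_apply, Units.smul_def, zsmul_eq_mul,
      Equiv.Perm.sign_permCongr]
    simp [Equiv.permCongr_apply]
  rw [Finset.sum_congr rfl fun σ _ => hterm σ,
    Finset.sum_eq_zero_iff_of_nonneg fun σ _ => sign_mul_prod_nonneg α b h1 h0 σ] at hsum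
  have := hsum 1 (Finset.mem_univ _)
  simp only [Equiv.Perm.sign_one, Equiv.Perm.coe_one, id] at this
  have hone : ∏ i : Fin n, α ![b (i, 0), b (i, 1)] = 1 := Finset.prod_eq_one fun i _ => h1 i
  rw [hone] at this
  simp at this

end

/-! ### Inverting the map from vectors to covectors. -/

section

variable {V : Type*} [NormedAddCommGroup V] [NormedSpace ℝ V] [FiniteDimensional ℝ V]

/-- The map `v ↦ α (v, ·)`. -/
def flatMap (α : V [⋀^Fin 2]→L[ℝ] ℝ) : V →L[ℝ] V →L[ℝ] ℝ :=
  LinearMap.toContinuousLinearMap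
    ((LinearMap.toContinuousLinearMap (𝕜 := ℝ) (E := V) (F' := ℝ)).toLinearMap ∘ₗ pairingForm α)

@[simp] theorem flatMap_apply (α : V [⋀^Fin 2]→L[ℝ] ℝ) (v w : V) :
    flatMap α v w = α ![v, w] := rfl

theorem flatMap_isInvertible (α : V [⋀^Fin 2]→L[ℝ] ℝ) (hα : ∀ v, (∀ w, α ![v, w] = 0) → v = 0) :
    (flatMap α).IsInvertible := by
  have hinj : Function.Injective (flatMap α).toLinearMap := by
    rw [injective_iff_map_eq_zero]
    exact fun v hv => hα v fun w => DFunLike.congr_fun hv w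
  have hdim : Module.finrank ℝ V = Module.finrank ℝ (V →L[ℝ] ℝ) := by
    rw [← (LinearMap.toContinuousLinearMap (𝕜 := ℝ) (E := V) (F' := ℝ)).finrank_eq]
    exact (Subspace.dual_finrank_eq (K := ℝ) (V := V)).symm
  exact ⟨(LinearEquiv.ofInjectiveOfFinrankEq
    (flatMap α).toLinearMap hinj hdim).toContinuousLinearEquiv,
    by ext; rfl⟩

/-- Inversion is smooth at invertible maps; this is the source of smoothness for Hamiltonian fields
in coordinates. -/
theorem contDiffOn_inverse_flatMap {W : Type*} [NormedAddCommGroup W] [NormedSpace ℝ W]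
    {α : W → V [⋀^Fin 2]→L[ℝ] ℝ} {β : W → V →L[ℝ] ℝ} {s : Set W} (hα : ContDiffOn ℝ ∞ α s)
    (hβ : ContDiffOn ℝ ∞ β s) (hnd : ∀ y ∈ s, ∀ v, (∀ w, α y ![v, w] = 0) → v = 0) :
    ContDiffOn ℝ ∞ (fun z => (flatMap (α z)).inverse (β z)) s := by
  have hflat : ContDiffOn ℝ ∞ (fun z => flatMap (α z)) s := by
    rw [contDiffOn_clm_apply]
    intro v
    rw [contDiffOn_clm_apply]
    intro w
    exact (ContinuousAlternatingMap.apply ℝ V ℝ ![v, w]).contDiff.comp_contDiffOn hα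
  have : CompleteSpace V := FiniteDimensional.complete ℝ V
  intro y hy
  exact ((flatMap_isInvertible _ (hnd y hy)).contDiffAt_map_inverse.comp_contDiffWithinAt y
    (hflat y hy)).clm_apply (hβ y hy)

end

/-! ### Hamiltonian vector fields and their coordinate expressions. -/

section

variable {E : Type*} [NormedAddCommGroup E] [NormedSpace ℝ E] {M : Type*}
  [TopologicalSpace M] [ChartedSpace E M]

/-- The derivative of a chart, as an endomorphism of the model space. -/
def chartDeriv (φ : OpenPartialHomeomorph M E) (x : M) : E →L[ℝ] E :=
  mfderiv 𝓘(ℝ, E) 𝓘(ℝ, E) φ x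

/-- The derivative of the inverse of a chart, as an endomorphism of the model space. -/
def chartSymmDeriv (φ : OpenPartialHomeomorph M E) (y : E) : E →L[ℝ] E :=
  mfderiv 𝓘(ℝ, E) 𝓘(ℝ, E) φ.symm y

/-- The value of a form at a point, as an alternating form on the model space. -/
def DiffForm.at {k : ℕ} (Ω : DiffForm E M k) (x : M) : E [⋀^Fin k]→L[ℝ] ℝ := Ω.val x

/-- The derivative of a function at a point, as a linear form on the model space. -/
def derivForm (h : M → ℝ) (x : M) : E →L[ℝ] ℝ := mfderiv 𝓘(ℝ, E) 𝓘(ℝ, ℝ) h x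

theorem chartDeriv_chartSymmDeriv [IsManifold 𝓘(ℝ, E) ∞ M]
    {φ : OpenPartialHomeomorph M E} (hφ : φ ∈ atlas E M) {y : E} (hy : y ∈ φ.target) (v : E) :
    chartDeriv φ (φ.symm y) (chartSymmDeriv φ y v) = v := by
  have hd : φ.MDifferentiable 𝓘(ℝ, E) 𝓘(ℝ, E) := mdifferentiable_of_mem_atlas hφ
  exact DFunLike.congr_fun (hd.comp_symm_deriv hy) v

theorem chartSymmDeriv_chartDeriv [IsManifold 𝓘(ℝ, E) ∞ M]
    {φ : OpenPartialHomeomorph M E} (hφ : φ ∈ atlas E M) {y : E} (hy : y ∈ φ.target) (v : E) :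
    chartSymmDeriv φ y (chartDeriv φ (φ.symm y) v) = v := by
  have hd : φ.MDifferentiable 𝓘(ℝ, E) 𝓘(ℝ, E) := mdifferentiable_of_mem_atlas hφ
  have h : chartSymmDeriv φ (φ (φ.symm y)) (chartDeriv φ (φ.symm y) v) = v :=
    DFunLike.congr_fun (hd.symm_comp_deriv (φ.map_target hy)) v
  rwa [φ.right_inv hy] at h

theorem DiffForm.inChart_apply (Ω : DiffForm E M 2) (φ : OpenPartialHomeomorph M E) (y v w : E) :
    Ω.inChart φ y ![v, w] =
      Ω.at (φ.symm y) ![chartSymmDeriv φ y v, chartSymmDeriv φ y w] := by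
  refine congrArg (Ω.at (φ.symm y)) ?_
  ext1 a
  fin_cases a <;> rfl

theorem DiffForm.IsSymplectic.at_nondegenerate {Ω : DiffForm E M 2}
    (hΩ : Ω.IsSymplectic) (x : M) (v : E) (hv : ∀ w, Ω.at x ![v, w] = 0) : v = 0 :=
  hΩ.2 x v hv

theorem DiffForm.inChart_nondegenerate [IsManifold 𝓘(ℝ, E) ∞ M] {Ω : DiffForm E M 2}
    (hΩ : Ω.IsSymplectic) {φ : OpenPartialHomeomorph M E} (hφ : φ ∈ atlas E M) {y : E}
    (hy : y ∈ φ.target) (v : E) (hv : ∀ w : E, Ω.inChart φ y ![v, w] = 0) : v = 0 := by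
  have h0 : chartSymmDeriv φ y v = 0 := by
    refine hΩ.at_nondegenerate (φ.symm y) _ fun w => ?_
    have h := hv (chartDeriv φ (φ.symm y) w)
    rwa [inChart_apply, chartSymmDeriv_chartDeriv hφ hy] at h
  rw [← chartDeriv_chartSymmDeriv hφ hy v, h0, map_zero]

variable [FiniteDimensional ℝ E]

/-- The value of the Hamiltonian vector field of `h` at a point. -/
def hamiltonianVector (Ω : DiffForm E M 2) (h : M → ℝ) (x : M) : E :=
  (flatMap (Ω.at x)).inverse (derivForm h x)

theorem at_hamiltonianVector {Ω : DiffForm E M 2} (hΩ : Ω.IsSymplectic) (h : M → ℝ) (x : M)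
    (v : E) : Ω.at x ![hamiltonianVector Ω h x, v] = derivForm h x v := by
  have hinv := flatMap_isInvertible _ (hΩ.at_nondegenerate x)
  exact DFunLike.congr_fun (hinv.self_apply_inverse (derivForm h x)) v

theorem eq_hamiltonianVector {Ω : DiffForm E M 2} (hΩ : Ω.IsSymplectic) {h : M → ℝ} {x : M}
    {X : E} (hX : ∀ v, Ω.at x ![X, v] = derivForm h x v) : X = hamiltonianVector Ω h x := by
  have hinv := flatMap_isInvertible _ (hΩ.at_nondegenerate x)
  refine hinv.injective ?_
  ext v
  rw [flatMap_apply, flatMap_apply, hX, at_hamiltonianVector hΩ]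

/-- Naturality under charts: by the chain rule both sides have the same pairing with every vector
under the coordinate form, which is nondegenerate. -/
theorem hamiltonianVector_inChart [IsManifold 𝓘(ℝ, E) ∞ M] {Ω : DiffForm E M 2}
    (hΩ : Ω.IsSymplectic) {h : M → ℝ} (hh : ContMDiff 𝓘(ℝ, E) 𝓘(ℝ, ℝ) ∞ h)
    {φ : OpenPartialHomeomorph M E} (hφ : φ ∈ atlas E M) {y : E} (hy : y ∈ φ.target) :
    chartDeriv φ (φ.symm y) (hamiltonianVector Ω h (φ.symm y)) =
      (flatMap (Ω.inChart φ y)).inverse (fderiv ℝ (h ∘ φ.symm) y) := by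
  have hinv := flatMap_isInvertible _ fun v => Ω.inChart_nondegenerate hΩ hφ hy v
  refine hinv.injective ?_
  rw [hinv.self_apply_inverse]
  ext w
  rw [flatMap_apply, DiffForm.inChart_apply, chartSymmDeriv_chartDeriv hφ hy,
    at_hamiltonianVector hΩ]
  have hd : φ.MDifferentiable 𝓘(ℝ, E) 𝓘(ℝ, E) := mdifferentiable_of_mem_atlas hφ
  have hcomp := mfderiv_comp y (hh.mdifferentiableAt (x := φ.symm y) (by simp))
    (hd.mdifferentiableAt_symm hy)
  rw [mfderiv_eq_fderiv] at hcomp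
  exact (DFunLike.congr_fun hcomp w).symm

/-- The Hamiltonian vector field of `h`. -/
def hamiltonianField (Ω : DiffForm E M 2) (h : M → ℝ) (x : M) : TangentSpace 𝓘(ℝ, E) x :=
  hamiltonianVector (E := E) Ω h x

theorem hamiltonianField_contMDiff [IsManifold 𝓘(ℝ, E) ∞ M] {Ω : DiffForm E M 2}
    (hΩ : Ω.IsSymplectic) {h : M → ℝ} (hh : ContMDiff 𝓘(ℝ, E) 𝓘(ℝ, ℝ) ∞ h) :
    ContMDiff 𝓘(ℝ, E) (𝓘(ℝ, E).prod 𝓘(ℝ, E)) ∞ (fun x =>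
      Bundle.TotalSpace.mk' E (E := fun x : M => TangentSpace 𝓘(ℝ, E) x) x
        (hamiltonianField Ω h x)) := by
  intro x₀
  rw [Bundle.contMDiffAt_section]
  set φ := chartAt E x₀ with hφdef
  have hφ : φ ∈ atlas E M := chart_mem_atlas E x₀
  have hx₀ : x₀ ∈ φ.source := mem_chart_source E x₀
  have hsmooth : ContDiffOn ℝ ∞
      (fun y => (flatMap (Ω.inChart φ y)).inverse (fderiv ℝ (h ∘ φ.symm) y)) φ.target := by
    have hc : ContDiffOn ℝ ∞ (h ∘ φ.symm) φ.target :=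
      (hh.comp_contMDiffOn (contMDiffOn_chart_symm (x := x₀))).contDiffOn
    exact contDiffOn_inverse_flatMap (Ω.smooth φ hφ)
      (hc.fderiv_of_isOpen φ.open_target (by simp))
      (fun y hy => Ω.inChart_nondegenerate hΩ hφ hy)
  have hcomp : ContMDiffAt 𝓘(ℝ, E) 𝓘(ℝ, E) ∞
      ((fun y => (flatMap (Ω.inChart φ y)).inverse (fderiv ℝ (h ∘ φ.symm) y)) ∘ φ) x₀ :=
    ((hsmooth.contDiffAt (φ.open_target.mem_nhds (φ.map_source hx₀))).contMDiffAt).comp x₀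
      ((contMDiffOn_chart (x := x₀)).contMDiffAt (φ.open_source.mem_nhds hx₀))
  refine hcomp.congr_of_eventuallyEq ?_
  filter_upwards [φ.open_source.mem_nhds hx₀] with x hx
  have hbase : x ∈ (trivializationAt E (fun x : M => TangentSpace 𝓘(ℝ, E) x) x₀).baseSet := hx
  -- The tangent trivialization at `x₀` acts on fibres as the derivative of the chart at `x₀`, so
  -- the local representative of the field is the coordinate expression composed with the chart.
  have h1 := DFunLike.congr_fun
    (TangentBundle.continuousLinearMapAt_trivializationAt (I := 𝓘(ℝ, E)) hx)
      (hamiltonianField Ω h x)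
  have h2 := (trivializationAt E (fun x : M => TangentSpace 𝓘(ℝ, E) x) x₀).linearMapAt_apply (R := ℝ)
    (hamiltonianField Ω h x)
  rw [if_pos hbase] at h2
  rw [Function.comp_apply, ← hamiltonianVector_inChart hΩ hh hφ (φ.map_source hx), φ.left_inv hx]
  exact h2.symm.trans h1

end

/-! ### The symplectic integral: finiteness, additivity, strict positivity. -/

section

variable {n : ℕ} {M : Type*} [TopologicalSpace M]
  [ChartedSpace (EuclideanSpace ℝ (Fin (2 * n))) M]

/-- The density of `|Ωⁿ|` with respect to Lebesgue measure in the chart at `p`. -/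
def chartDensity (Ω : DiffForm (EuclideanSpace ℝ (Fin (2 * n))) M 2) (p : M)
    (y : EuclideanSpace ℝ (Fin (2 * n))) : ℝ :=
  |wedgePow (Ω.inChart (chartAt (EuclideanSpace ℝ (Fin (2 * n))) p) y) n
    (fun j => EuclideanSpace.single j (1 : ℝ))|

theorem continuousOn_chartDensity (Ω : DiffForm (EuclideanSpace ℝ (Fin (2 * n))) M 2) (p : M) :
    ContinuousOn (chartDensity Ω p) (chartAt (EuclideanSpace ℝ (Fin (2 * n))) p).target := by
  have hΩ : ContinuousOn (Ω.inChart (chartAt (EuclideanSpace ℝ (Fin (2 * n))) p))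
      (chartAt (EuclideanSpace ℝ (Fin (2 * n))) p).target :=
    (Ω.smooth _ (chart_mem_atlas _ p)).continuousOn
  have hv : ∀ v, ContinuousOn
      (fun y => Ω.inChart (chartAt (EuclideanSpace ℝ (Fin (2 * n))) p) y v)
      (chartAt (EuclideanSpace ℝ (Fin (2 * n))) p).target := fun v =>
    (ContinuousAlternatingMap.apply ℝ (EuclideanSpace ℝ (Fin (2 * n))) ℝ v).continuous.comp_continuousOn
      hΩ
  unfold chartDensity wedgePow
  exact (continuousOn_const.mul (continuousOn_finsetSum _ fun σ _ =>
    continuousOn_const.mul (continuousOn_finsetProd _ fun i _ => hv _))).abs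

variable [IsManifold 𝓘(ℝ, EuclideanSpace ℝ (Fin (2 * n))) ∞ M]

theorem chartDensity_pos {Ω : DiffForm (EuclideanSpace ℝ (Fin (2 * n))) M 2}
    (hΩ : Ω.IsSymplectic) {p : M} {y : EuclideanSpace ℝ (Fin (2 * n))}
    (hy : y ∈ (chartAt (EuclideanSpace ℝ (Fin (2 * n))) p).target) : 0 < chartDensity Ω p y := by
  have h := wedgePow_basis_ne_zero (n := n)
    (Ω.inChart (chartAt (EuclideanSpace ℝ (Fin (2 * n))) p) y)
    (Ω.inChart_nondegenerate hΩ (chart_mem_atlas _ p) hy)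
    (EuclideanSpace.basisFun (Fin (2 * n)) ℝ).toBasis
  rw [chartDensity, abs_pos]
  convert! h using 2
  ext1 j
  simp

variable [T2Space M] [SigmaCompactSpace M]

/-- The integrand of the contribution of the chart at `p` to the integral of `f Ωⁿ`. -/
def chartIntegrand (Ω : DiffForm (EuclideanSpace ℝ (Fin (2 * n))) M 2) (f : M → ℝ) (p : M)
    (y : EuclideanSpace ℝ (Fin (2 * n))) : ℝ :=
  chartPartition n M p ((chartAt (EuclideanSpace ℝ (Fin (2 * n))) p).symm y) *
    f ((chartAt (EuclideanSpace ℝ (Fin (2 * n))) p).symm y) * chartDensity Ω p y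

theorem symplecticIntegral_eq (Ω : DiffForm (EuclideanSpace ℝ (Fin (2 * n))) M 2) (f : M → ℝ) :
    symplecticIntegral Ω f = ∑ᶠ p : M, ∫ y in (chartAt (EuclideanSpace ℝ (Fin (2 * n))) p).target,
      chartIntegrand Ω f p y := rfl

theorem tsupport_chartPartition_subset (p : M) :
    tsupport (chartPartition n M p) ⊆ (chartAt (EuclideanSpace ℝ (Fin (2 * n))) p).source :=
  Classical.choose_spec (SmoothPartitionOfUnity.exists_isSubordinate_chartAt_source
    𝓘(ℝ, EuclideanSpace ℝ (Fin (2 * n))) M) p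

theorem continuousOn_chartIntegrand (Ω : DiffForm (EuclideanSpace ℝ (Fin (2 * n))) M 2)
    {f : M → ℝ} (hf : Continuous f) (p : M) :
    ContinuousOn (chartIntegrand Ω f p) (chartAt (EuclideanSpace ℝ (Fin (2 * n))) p).target := by
  have hsymm := (chartAt (EuclideanSpace ℝ (Fin (2 * n))) p).continuousOn_symm
  have hρ : Continuous (chartPartition n M p) := ((chartPartition n M) p).contMDiff.continuous
  exact ((hρ.comp_continuousOn hsymm).mul (hf.comp_continuousOn hsymm)).mul
    (continuousOn_chartDensity Ω p)

/-- The integrand is continuous on the chart target and vanishes there off the image of `tsupport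
ρ_p ∩ tsupport f`, which is compact and inside the target. -/
theorem integrableOn_chartIntegrand (Ω : DiffForm (EuclideanSpace ℝ (Fin (2 * n))) M 2)
    {f : M → ℝ} (hf : Continuous f) (hfc : HasCompactSupport f) (p : M) :
    IntegrableOn (chartIntegrand Ω f p) (chartAt (EuclideanSpace ℝ (Fin (2 * n))) p).target := by
  set φ := chartAt (EuclideanSpace ℝ (Fin (2 * n))) p with hφ
  set K : Set M := tsupport (chartPartition n M p) ∩ tsupport f with hK
  have hKs : K ⊆ φ.source := Set.inter_subset_left.trans (tsupport_chartPartition_subset p)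
  have hKc : IsCompact (φ '' K) :=
    (hfc.isCompact.inter_left (isClosed_tsupport _)).image_of_continuousOn
      (φ.continuousOn.mono hKs)
  have hsub : φ '' K ⊆ φ.target := by
    rintro _ ⟨x, hx, rfl⟩
    exact φ.map_source (hKs hx)
  have hint : IntegrableOn (chartIntegrand Ω f p) (φ '' K) :=
    ((continuousOn_chartIntegrand Ω hf p).mono hsub).integrableOn_compact hKc
  refine hint.of_forall_sdiff_eq_zero φ.open_target.measurableSet fun y hy => ?_
  have hy' : φ.symm y ∉ K := fun h => hy.2 ⟨_, h, φ.right_inv hy.1⟩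
  by_contra hne
  have h1 := left_ne_zero_of_mul hne
  exact hy' ⟨subset_tsupport _ (left_ne_zero_of_mul h1), subset_tsupport _ (right_ne_zero_of_mul h1)⟩

/-- By local finiteness only finitely many `ρ_p` meet the compact support of `f`. This ensures that
the `finsum` is a true sum and not the default value 0. -/
theorem finite_support_chartIntegral (Ω : DiffForm (EuclideanSpace ℝ (Fin (2 * n))) M 2)
    {f : M → ℝ} (hfc : HasCompactSupport f) :
    (Function.support fun p : M =>
      ∫ y in (chartAt (EuclideanSpace ℝ (Fin (2 * n))) p).target, chartIntegrand Ω f p y).Finite := by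
  refine ((chartPartition n M).locallyFinite.finite_nonempty_inter_compact
    hfc.isCompact).subset fun p hp => ?_
  by_contra hne
  rw [Set.mem_ofPred_eq, Set.not_nonempty_iff_eq_empty] at hne
  refine hp ?_
  have : chartIntegrand Ω f p = 0 := by
    ext y
    by_contra h
    have h1 := left_ne_zero_of_mul h
    exact Set.eq_empty_iff_forall_notMem.1 hne _
      ⟨left_ne_zero_of_mul h1, subset_tsupport _ (right_ne_zero_of_mul h1)⟩
  simp [this]

theorem symplecticIntegral_add (Ω : DiffForm (EuclideanSpace ℝ (Fin (2 * n))) M 2)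
    {f g : M → ℝ} (hf : Continuous f) (hfc : HasCompactSupport f) (hg : Continuous g)
    (hgc : HasCompactSupport g) :
    symplecticIntegral Ω (fun x => f x + g x) =
      symplecticIntegral Ω f + symplecticIntegral Ω g := by
  rw [symplecticIntegral_eq, symplecticIntegral_eq, symplecticIntegral_eq,
    ← finsum_add_distrib (finite_support_chartIntegral Ω hfc)
      (finite_support_chartIntegral Ω hgc)]
  refine finsum_congr fun p => ?_
  rw [← integral_add (integrableOn_chartIntegrand Ω hf hfc p)
    (integrableOn_chartIntegrand Ω hg hgc p)]
  refine integral_congr_ae (.of_forall fun y => ?_)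
  simp only [chartIntegrand]
  ring

theorem symplecticIntegral_neg (Ω : DiffForm (EuclideanSpace ℝ (Fin (2 * n))) M 2) (f : M → ℝ) :
    symplecticIntegral Ω (fun x => -f x) = -symplecticIntegral Ω f := by
  rw [symplecticIntegral_eq, symplecticIntegral_eq, ← finsum_neg_distrib]
  refine finsum_congr fun p => ?_
  rw [← integral_neg]
  refine integral_congr_ae (.of_forall fun y => ?_)
  simp only [chartIntegrand]
  ring

/-- Every chart contributes a nonnegative amount. For a `p` with `ρ_p x₀ > 0`, the integrand is
nonzero on a nonempty open set, which has positive Lebesgue measure. -/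
theorem symplecticIntegral_pos {Ω : DiffForm (EuclideanSpace ℝ (Fin (2 * n))) M 2}
    (hΩ : Ω.IsSymplectic) {f : M → ℝ} (hf : Continuous f) (hfc : HasCompactSupport f)
    (hf0 : ∀ x, 0 ≤ f x) {x₀ : M} (hx₀ : 0 < f x₀) : 0 < symplecticIntegral Ω f := by
  have hnonneg : ∀ p y, 0 ≤ chartIntegrand Ω f p y := fun p y =>
    mul_nonneg (mul_nonneg ((chartPartition n M).nonneg p _) (hf0 _)) (abs_nonneg _)
  obtain ⟨p, hp⟩ := (chartPartition n M).exists_pos_of_mem (Set.mem_univ x₀)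
  refine finsum_pos (fun p => integral_nonneg (hnonneg p)) ⟨p, ?_⟩
    (finite_support_chartIntegral Ω hfc)
  set φ := chartAt (EuclideanSpace ℝ (Fin (2 * n))) p with hφ
  have hx : x₀ ∈ φ.source := tsupport_chartPartition_subset p (subset_tsupport _ hp.ne')
  change 0 < ∫ y in φ.target, chartIntegrand Ω f p y
  rw [setIntegral_pos_iff_support_of_nonneg_ae (.of_forall (hnonneg p))
    (integrableOn_chartIntegrand Ω hf hfc p)]
  have hopen : IsOpen (φ.target ∩ chartIntegrand Ω f p ⁻¹' {0}ᶜ) :=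
    (continuousOn_chartIntegrand Ω hf p).isOpen_inter_preimage φ.open_target isOpen_compl_singleton
  rw [Set.inter_comm]
  refine hopen.measure_pos volume ⟨φ x₀, φ.map_source hx, ?_⟩
  have : 0 < chartIntegrand Ω f p (φ x₀) := by
    rw [chartIntegrand, ← hφ, φ.left_inv hx]
    exact mul_pos (mul_pos hp hx₀) (chartDensity_pos hΩ (φ.map_source hx))
  exact this.ne'

end

/-! ### Differentials of products, and functions with prescribed differential. -/

section

variable {E : Type*} [NormedAddCommGroup E] [NormedSpace ℝ E] {M : Type*}
  [TopologicalSpace M] [ChartedSpace E M]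

theorem derivForm_mul_comp {a φ : M → ℝ} (ha : ContMDiff 𝓘(ℝ, E) 𝓘(ℝ, ℝ) ∞ a)
    (hφ : ContMDiff 𝓘(ℝ, E) 𝓘(ℝ, ℝ) ∞ φ) {c : ℝ → ℝ} {c' : ℝ} {x : M}
    (hc : HasDerivAt c c' (φ x)) :
    (derivForm (fun z => a z * c (φ z)) x : E →L[ℝ] ℝ) =
      c (φ x) • derivForm a x + (a x * c') • derivForm φ x := by
  have h1 : HasMFDerivAt 𝓘(ℝ, E) 𝓘(ℝ, ℝ) a x (mfderiv 𝓘(ℝ, E) 𝓘(ℝ, ℝ) a x) :=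
    (ha.mdifferentiableAt (by simp)).hasMFDerivAt
  have h2 : HasMFDerivAt 𝓘(ℝ, E) 𝓘(ℝ, ℝ) φ x (mfderiv 𝓘(ℝ, E) 𝓘(ℝ, ℝ) φ x) :=
    (hφ.mdifferentiableAt (by simp)).hasMFDerivAt
  have h3 := hc.hasFDerivAt.hasMFDerivAt.comp x h2
  have h4 := (h1.mul h3).mfderiv
  refine Eq.trans h4 ?_
  refine ContinuousLinearMap.ext fun v : E => ?_
  change a x * (derivForm (E := E) φ x v * c') + c (φ x) * derivForm (E := E) a x v =
    c (φ x) * derivForm (E := E) a x v + a x * c' * derivForm (E := E) φ x v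
  ring

theorem derivForm_eq_zero {h : M → ℝ} {x : M} (hx : x ∉ tsupport h) :
    (derivForm h x : E →L[ℝ] ℝ) = 0 := by
  have h0 : h =ᶠ[nhds x] fun _ => (0 : ℝ) := notMem_tsupport_iff_eventuallyEq.1 hx
  exact (h0.mfderiv_eq (I := 𝓘(ℝ, E)) (I' := 𝓘(ℝ, ℝ))).trans mfderiv_const

theorem hamiltonianVector_eq_zero [FiniteDimensional ℝ E] {Ω : DiffForm E M 2} {h : M → ℝ} {x : M}
    (hx : x ∉ tsupport h) : hamiltonianVector Ω h x = 0 := by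
  rw [hamiltonianVector, derivForm_eq_zero hx, map_zero]

theorem exists_contMDiff_derivForm_eq [FiniteDimensional ℝ E] [T2Space M]
    [IsManifold 𝓘(ℝ, E) ∞ M] (x : M) (l : E →L[ℝ] ℝ) :
    ∃ φ : M → ℝ, ContMDiff 𝓘(ℝ, E) 𝓘(ℝ, ℝ) ∞ φ ∧ derivForm φ x = l := by
  obtain ⟨b⟩ : Nonempty (SmoothBumpFunction 𝓘(ℝ, E) x) := inferInstance
  have hl : ContMDiffOn 𝓘(ℝ, E) 𝓘(ℝ, ℝ) ∞ (fun z => l (chartAt E x z)) (chartAt E x).source :=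
    l.contMDiff.comp_contMDiffOn (contMDiffOn_chart (x := x))
  refine ⟨fun z => b z • l (chartAt E x z), b.contMDiff_smul hl, ?_⟩
  have heq : (fun z => b z • l (chartAt E x z)) =ᶠ[nhds x] (l ∘ extChartAt 𝓘(ℝ, E) x) := by
    filter_upwards [b.eventuallyEq_one] with z hz
    simp [hz]
  -- The tangent space at `x` is identified with `E` through the preferred chart at `x`, whose
  -- derivative there is thus the identity; hence `l` composed with this chart has differential
  -- exactly `l`.
  have h1 : HasMFDerivAt 𝓘(ℝ, E) 𝓘(ℝ, E) (extChartAt 𝓘(ℝ, E) x) x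
      (ContinuousLinearMap.id ℝ E) := by
    have := (mdifferentiableAt_extChartAt (I := 𝓘(ℝ, E)) (mem_chart_source E x)).hasMFDerivAt
    rwa [mfderiv_extChartAt_self] at this
  have h2 := (l.hasFDerivAt.hasMFDerivAt.comp x h1).mfderiv
  refine (heq.mfderiv_eq (I := 𝓘(ℝ, E)) (I' := 𝓘(ℝ, ℝ))).trans (h2.trans ?_)
  rfl

end

/-! ### The quadratic expression `T(X_h, X_h)` and the rotation identity. -/

section

variable {n : ℕ} {M : Type*} [TopologicalSpace M]
  [ChartedSpace (EuclideanSpace ℝ (Fin (2 * n))) M]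
  [IsManifold 𝓘(ℝ, EuclideanSpace ℝ (Fin (2 * n))) ∞ M]

theorem continuous_tensor_apply (T : SmoothTwoTensor n M) (X Y : SmoothVectorField n M) :
    Continuous fun x => T x (X x) (Y x) := by
  have h : ContMDiff 𝓘(ℝ, EuclideanSpace ℝ (Fin (2 * n)))
      (𝓘(ℝ, EuclideanSpace ℝ (Fin (2 * n))).prod 𝓘(ℝ, ℝ)) ∞ (fun x =>
        Bundle.TotalSpace.mk' ℝ (E := Bundle.Trivial M ℝ) x (T x (X x) (Y x))) :=
    ContMDiff.clm_bundle_apply₂ (F₁ := EuclideanSpace ℝ (Fin (2 * n)))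
      (F₂ := EuclideanSpace ℝ (Fin (2 * n)))
      (E₁ := fun x : M => TangentSpace 𝓘(ℝ, EuclideanSpace ℝ (Fin (2 * n))) x)
      (E₂ := fun x : M => TangentSpace 𝓘(ℝ, EuclideanSpace ℝ (Fin (2 * n))) x)
      T.contMDiff X.contMDiff Y.contMDiff
  have h2 : ContMDiff 𝓘(ℝ, EuclideanSpace ℝ (Fin (2 * n))) 𝓘(ℝ, ℝ) ∞
      (fun x => T x (X x) (Y x)) := fun x => by
    have := h x
    rw [Bundle.contMDiffAt_section] at this
    exact this
  exact h2.continuous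

/-- The value of a tensor field at a point, as a bilinear form on the model space. -/
def tensorAt (T : SmoothTwoTensor n M) (x : M) :
    EuclideanSpace ℝ (Fin (2 * n)) →L[ℝ] EuclideanSpace ℝ (Fin (2 * n)) →L[ℝ] ℝ := T x

/-- The function `T(X_h, X_h)`. -/
def hamiltonianEnergy (Ω : DiffForm (EuclideanSpace ℝ (Fin (2 * n))) M 2)
    (T : SmoothTwoTensor n M) (h : M → ℝ) (x : M) : ℝ :=
  tensorAt T x (hamiltonianVector Ω h x) (hamiltonianVector Ω h x)

/-- The Hamiltonian vector field of a smooth function, as a smooth vector field. -/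
def smoothHamiltonianField {Ω : DiffForm (EuclideanSpace ℝ (Fin (2 * n))) M 2}
    (hΩ : Ω.IsSymplectic) {h : M → ℝ}
    (hh : ContMDiff 𝓘(ℝ, EuclideanSpace ℝ (Fin (2 * n))) 𝓘(ℝ, ℝ) ∞ h) : SmoothVectorField n M :=
  ⟨hamiltonianField Ω h, hamiltonianField_contMDiff hΩ hh⟩

theorem continuous_hamiltonianEnergy {Ω : DiffForm (EuclideanSpace ℝ (Fin (2 * n))) M 2}
    (hΩ : Ω.IsSymplectic) (T : SmoothTwoTensor n M) {h : M → ℝ}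
    (hh : ContMDiff 𝓘(ℝ, EuclideanSpace ℝ (Fin (2 * n))) 𝓘(ℝ, ℝ) ∞ h) :
    Continuous (hamiltonianEnergy Ω T h) :=
  continuous_tensor_apply T (smoothHamiltonianField hΩ hh) (smoothHamiltonianField hΩ hh)

theorem hasCompactSupport_hamiltonianEnergy [T2Space M]
    {Ω : DiffForm (EuclideanSpace ℝ (Fin (2 * n))) M 2}
    (T : SmoothTwoTensor n M) {h : M → ℝ} (hc : HasCompactSupport h) :
    HasCompactSupport (hamiltonianEnergy Ω T h) :=
  HasCompactSupport.intro hc fun x hx => by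
    rw [hamiltonianEnergy, hamiltonianVector_eq_zero hx, map_zero]

theorem smoothHamiltonianField_mem [T2Space M]
    {Ω : DiffForm (EuclideanSpace ℝ (Fin (2 * n))) M 2}
    (hΩ : Ω.IsSymplectic) {h : M → ℝ}
    (hh : ContMDiff 𝓘(ℝ, EuclideanSpace ℝ (Fin (2 * n))) 𝓘(ℝ, ℝ) ∞ h) (hc : HasCompactSupport h) :
    smoothHamiltonianField hΩ hh ∈ compactHamiltonianFields Ω := by
  refine ⟨hc.isCompact.of_isClosed_subset isClosed_closure
    (closure_minimal (fun x hx => ?_) (isClosed_tsupport h)), h, hh, at_hamiltonianVector hΩ h⟩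
  by_contra hx'
  exact hx (hamiltonianVector_eq_zero (E := EuclideanSpace ℝ (Fin (2 * n))) hx')

/-- The rotation `(a cos φ, a sin φ)` separates the top order part of `T(X_a, X_a)`. -/
theorem hamiltonianEnergy_cos_add_sin (Ω : DiffForm (EuclideanSpace ℝ (Fin (2 * n))) M 2)
    (T : SmoothTwoTensor n M) {a φ : M → ℝ}
    (ha : ContMDiff 𝓘(ℝ, EuclideanSpace ℝ (Fin (2 * n))) 𝓘(ℝ, ℝ) ∞ a)
    (hφ : ContMDiff 𝓘(ℝ, EuclideanSpace ℝ (Fin (2 * n))) 𝓘(ℝ, ℝ) ∞ φ) (x : M) :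
    hamiltonianEnergy Ω T (fun z => a z * Real.cos (φ z)) x +
        hamiltonianEnergy Ω T (fun z => a z * Real.sin (φ z)) x =
      hamiltonianEnergy Ω T a x + a x ^ 2 * hamiltonianEnergy Ω T φ x := by
  have hcos : hamiltonianVector Ω (fun z => a z * Real.cos (φ z)) x =
      Real.cos (φ x) • hamiltonianVector Ω a x +
        (a x * -Real.sin (φ x)) • hamiltonianVector Ω φ x := by
    rw [hamiltonianVector, derivForm_mul_comp ha hφ (Real.hasDerivAt_cos (φ x)), map_add,
      map_smul, map_smul]
    rfl
  have hsin : hamiltonianVector Ω (fun z => a z * Real.sin (φ z)) x =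
      Real.sin (φ x) • hamiltonianVector Ω a x +
        (a x * Real.cos (φ x)) • hamiltonianVector Ω φ x := by
    rw [hamiltonianVector, derivForm_mul_comp ha hφ (Real.hasDerivAt_sin (φ x)), map_add,
      map_smul, map_smul]
    rfl
  simp only [hamiltonianEnergy, hcos, hsin, map_add, map_smul, add_apply,
    smul_apply, smul_eq_mul]
  -- The mixed terms carry coefficients `∓ a cos φ sin φ` and cancel separately in each order of the
  -- arguments; the diagonal terms carry `cos² + sin²`.
  linear_combination (tensorAt T x (hamiltonianVector Ω a x) (hamiltonianVector Ω a x) +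
    a x ^ 2 * tensorAt T x (hamiltonianVector Ω φ x) (hamiltonianVector Ω φ x)) *
      Real.cos_sq_add_sin_sq (φ x)

/-! ### Localisation by bump functions and polarisation. -/

variable [T2Space M] [SigmaCompactSpace M]

/-- The hypothesis applies to `a`, `a cos φ` and `a sin φ`, all supported in the support of `a`; `φ`
itself may have noncompact support. Integrating the rotation identity isolates the remaining term.
-/
theorem symplecticIntegral_sq_mul_hamiltonianEnergy
    {Ω : DiffForm (EuclideanSpace ℝ (Fin (2 * n))) M 2} (hΩ : Ω.IsSymplectic)
    {T : SmoothTwoTensor n M}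
    (hT : ∀ X ∈ compactHamiltonianFields Ω, ∀ Y ∈ compactHamiltonianFields Ω,
      symplecticIntegral Ω (fun x => T x (X x) (Y x)) = 0) {a φ : M → ℝ}
    (ha : ContMDiff 𝓘(ℝ, EuclideanSpace ℝ (Fin (2 * n))) 𝓘(ℝ, ℝ) ∞ a) (hac : HasCompactSupport a)
    (hφ : ContMDiff 𝓘(ℝ, EuclideanSpace ℝ (Fin (2 * n))) 𝓘(ℝ, ℝ) ∞ φ) :
    symplecticIntegral Ω (fun x => a x ^ 2 * hamiltonianEnergy Ω T φ x) = 0 := by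
  have hzero : ∀ {h : M → ℝ}, ContMDiff 𝓘(ℝ, EuclideanSpace ℝ (Fin (2 * n))) 𝓘(ℝ, ℝ) ∞ h →
      HasCompactSupport h → symplecticIntegral Ω (hamiltonianEnergy Ω T h) = 0 := fun hh hc =>
    hT _ (smoothHamiltonianField_mem hΩ hh hc) _ (smoothHamiltonianField_mem hΩ hh hc)
  have hcos : ContMDiff 𝓘(ℝ, EuclideanSpace ℝ (Fin (2 * n))) 𝓘(ℝ, ℝ) ∞
      (fun z => a z * Real.cos (φ z)) := ha.mul (Real.contDiff_cos.contMDiff.comp hφ)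
  have hsin : ContMDiff 𝓘(ℝ, EuclideanSpace ℝ (Fin (2 * n))) 𝓘(ℝ, ℝ) ∞
      (fun z => a z * Real.sin (φ z)) := ha.mul (Real.contDiff_sin.contMDiff.comp hφ)
  have hcosc : HasCompactSupport (fun z => a z * Real.cos (φ z)) := hac.mul_right
  have hsinc : HasCompactSupport (fun z => a z * Real.sin (φ z)) := hac.mul_right
  have hsq : HasCompactSupport (fun x => a x ^ 2 * hamiltonianEnergy Ω T φ x) :=
    HasCompactSupport.intro hac fun x hx => by simp [image_eq_zero_of_notMem_tsupport hx]
  have h1 := symplecticIntegral_add Ω (continuous_hamiltonianEnergy hΩ T hcos)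
    (hasCompactSupport_hamiltonianEnergy T hcosc) (continuous_hamiltonianEnergy hΩ T hsin)
    (hasCompactSupport_hamiltonianEnergy T hsinc)
  have h2 := symplecticIntegral_add Ω (g := fun x => a x ^ 2 * hamiltonianEnergy Ω T φ x)
    (continuous_hamiltonianEnergy hΩ T ha)
    (hasCompactSupport_hamiltonianEnergy T hac)
    ((ha.continuous.pow 2).mul (continuous_hamiltonianEnergy hΩ T hφ)) hsq
  simp only [hamiltonianEnergy_cos_add_sin Ω T ha hφ] at h1
  rw [hzero hcos hcosc, hzero hsin hsinc] at h1
  rw [hzero ha hac, h1] at h2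
  linarith

theorem hamiltonianEnergy_eq_zero
    {Ω : DiffForm (EuclideanSpace ℝ (Fin (2 * n))) M 2} (hΩ : Ω.IsSymplectic)
    {T : SmoothTwoTensor n M}
    (hT : ∀ X ∈ compactHamiltonianFields Ω, ∀ Y ∈ compactHamiltonianFields Ω,
      symplecticIntegral Ω (fun x => T x (X x) (Y x)) = 0) {φ : M → ℝ}
    (hφ : ContMDiff 𝓘(ℝ, EuclideanSpace ℝ (Fin (2 * n))) 𝓘(ℝ, ℝ) ∞ φ) (x₀ : M) :
    hamiltonianEnergy Ω T φ x₀ = 0 := by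
  have hcont := continuous_hamiltonianEnergy hΩ T hφ
  have hbump : ∀ s : Set M, IsOpen s → x₀ ∈ s → ∃ a : M → ℝ,
      ContMDiff 𝓘(ℝ, EuclideanSpace ℝ (Fin (2 * n))) 𝓘(ℝ, ℝ) ∞ a ∧ HasCompactSupport a ∧
        a x₀ = 1 ∧ ∀ x ∉ s, a x = 0 := fun s hs hx => by
    obtain ⟨b, hb, -⟩ := (SmoothBumpFunction.nhds_basis_support
      (I := 𝓘(ℝ, EuclideanSpace ℝ (Fin (2 * n)))) (hs.mem_nhds hx)).mem_iff.1 Filter.univ_mem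
    exact ⟨b, b.contMDiff, b.hasCompactSupport, b.eq_one, fun x hx =>
      image_eq_zero_of_notMem_tsupport fun h => hx (hb h)⟩
  have hsupp : ∀ a : M → ℝ, HasCompactSupport a →
      HasCompactSupport (fun x => a x ^ 2 * hamiltonianEnergy Ω T φ x) := fun a hac =>
    HasCompactSupport.intro hac fun x hx => by simp [image_eq_zero_of_notMem_tsupport hx]
  -- If the value at `x₀` is nonzero, its sign persists on an open set; a bump function vanishing
  -- outside that set gives an integrand of one sign, nonzero at `x₀`, whose integral cannot vanish.
  rcases lt_trichotomy (hamiltonianEnergy Ω T φ x₀) 0 with h | h | h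
  · obtain ⟨a, ha, hac, ha1, ha0⟩ := hbump _ (isOpen_Iio.preimage hcont) h
    have hint := symplecticIntegral_sq_mul_hamiltonianEnergy hΩ hT ha hac hφ
    have hpos := symplecticIntegral_pos hΩ (f := fun x => -(a x ^ 2 * hamiltonianEnergy Ω T φ x))
      ((ha.continuous.pow 2).mul hcont).neg (hsupp a hac).neg (fun x => by
        by_cases hx : hamiltonianEnergy Ω T φ x < 0
        · nlinarith [sq_nonneg (a x)]
        · simp [ha0 x hx]) (x₀ := x₀) (by simpa [ha1] using h)
    rw [symplecticIntegral_neg, hint] at hpos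
    simp at hpos
  · exact h
  · obtain ⟨a, ha, hac, ha1, ha0⟩ := hbump _ (isOpen_Ioi.preimage hcont) h
    have hint := symplecticIntegral_sq_mul_hamiltonianEnergy hΩ hT ha hac hφ
    have hpos := symplecticIntegral_pos hΩ (f := fun x => a x ^ 2 * hamiltonianEnergy Ω T φ x)
      ((ha.continuous.pow 2).mul hcont) (hsupp a hac) (fun x => by
        by_cases hx : 0 < hamiltonianEnergy Ω T φ x
        · positivity
        · simp [ha0 x hx]) (x₀ := x₀) (by simpa [ha1] using h)
    exact absurd hint hpos.ne'

theorem tensorAt_self_eq_zero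
    {Ω : DiffForm (EuclideanSpace ℝ (Fin (2 * n))) M 2} (hΩ : Ω.IsSymplectic)
    {T : SmoothTwoTensor n M}
    (hT : ∀ X ∈ compactHamiltonianFields Ω, ∀ Y ∈ compactHamiltonianFields Ω,
      symplecticIntegral Ω (fun x => T x (X x) (Y x)) = 0) (x : M)
    (v : EuclideanSpace ℝ (Fin (2 * n))) : tensorAt T x v v = 0 := by
  -- Choosing `dφ = Ω(v, ·)` at `x` makes `v` the value of `X_φ` there, by nondegeneracy.
  obtain ⟨φ, hφ, hd⟩ := exists_contMDiff_derivForm_eq x (flatMap (Ω.at x) v)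
  have hv : v = hamiltonianVector Ω φ x := eq_hamiltonianVector hΩ fun w => by
    rw [hd, flatMap_apply]
  rw [hv]
  exact hamiltonianEnergy_eq_zero hΩ hT hφ x

theorem tensorAt_eq_zero
    {Ω : DiffForm (EuclideanSpace ℝ (Fin (2 * n))) M 2} (hΩ : Ω.IsSymplectic)
    {T : SmoothTwoTensor n M} (hsymm : ∀ (x : M) (v w), T x v w = T x w v)
    (hT : ∀ X ∈ compactHamiltonianFields Ω, ∀ Y ∈ compactHamiltonianFields Ω,
      symplecticIntegral Ω (fun x => T x (X x) (Y x)) = 0) (x : M)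
    (v w : EuclideanSpace ℝ (Fin (2 * n))) : tensorAt T x v w = 0 := by
  have hs : tensorAt T x v w = tensorAt T x w v := hsymm x v w
  have hvw := tensorAt_self_eq_zero hΩ hT x (v + w)
  rw [map_add, map_add, add_apply, add_apply, tensorAt_self_eq_zero hΩ hT x v,
    tensorAt_self_eq_zero hΩ hT x w, hs] at hvw
  linarith

end

theorem mainTheorem8 (n : ℕ) (M : Type*) [TopologicalSpace M] [T2Space M] [SigmaCompactSpace M]
    [ChartedSpace (EuclideanSpace ℝ (Fin (2 * n))) M]
    [IsManifold 𝓘(ℝ, EuclideanSpace ℝ (Fin (2 * n))) ∞ M]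
    (Ω : DiffForm (EuclideanSpace ℝ (Fin (2 * n))) M 2) (hΩ : Ω.IsSymplectic) :
    DetectsSymmetricTensors Ω (compactHamiltonianFields Ω) := by
  intro T hsymm hT x
  exact tensorAt_eq_zero hΩ hsymm hT x

end
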